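/- There exist an absolute constant $c>0$ and, for every integer $k\ge 3$, a convex $k$-gon $\mathcal P_k\subset\mathbb R^2$ (a closed polygonal curve, the boundary of the convex hull of its $k$ vertices, which are in convex position) with the origin in its interior, and a bounded set $B_k\subset\mathbb R^2$, such that the following hold. 1. Each $\mathcal P_k$ is a lattice polygon up to scaling: there is a positive integer $m_k$ such that all vertices of $\mathcal P_k$ lie in $m_k^{-1}\mathbb Z^2$. 2. As $k\to\infty$, $\mathcal P_k$ converges in the Hausdorff metric to the unit circle $\{x\in\mathbb R^2:|x|=1\}$. 3. For every $k\ge 3$ and every $x\in[0,1]^2$, the set $B_k$ contains the vertices of a scaled and rotated copy of $\mathcal P_k$ centred at $x$: there are $s>0$ and a rotation $R$ about the origin with $x+sRv\in B_k$ for every vertex $v$ of $\mathcal P_k$. 4. For every $k\ge 3$, $$\dim_M B_k\le 2-\frac{c}{\log k}.$$ Here $\dim_M E=\limsup_{\epsilon\to0^+}\frac{\log N_E(\epsilon)}{\log(1/\epsilon)}$ is the Minkowski (upper box) dimension, where $N_E(\epsilon)$ is the least positive number of axis-parallel boxes of side length at most $\epsilon$ that cover $E$. -/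

import Mathlib

open Filter Topology

/-- The Euclidean plane `ℝ²`. -/
abbrev Plane : Type := EuclideanSpace ℝ (Fin 2)

/-- `E` can be covered by `N` axis-parallel boxes `∏ i, [a i, b i]` all of whose side lengths
are at most `ε`. -/
def CoveredByBoxes {n : ℕ} (E : Set (EuclideanSpace ℝ (Fin n))) (ε : ℝ) (N : ℕ) : Prop :=
  ∃ a b : Fin N → Fin n → ℝ,
    (∀ j i, a j i ≤ b j i ∧ b j i - a j i ≤ ε) ∧
      ∀ x ∈ E, ∃ j, ∀ i, x i ∈ Set.Icc (a j i) (b j i)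

/-- The smallest positive number of boxes of side length at most `ε` that cover `E`
(`⊤` if no finite number suffices). -/
noncomputable def boxCoveringNumber {n : ℕ} (E : Set (EuclideanSpace ℝ (Fin n))) (ε : ℝ) : ℕ∞ :=
  ⨅ (N : ℕ) (_ : 0 < N ∧ CoveredByBoxes E ε N), (N : ℕ∞)

/-- The Minkowski (upper box) dimension
`limsup_{ε → 0⁺} log N_E(ε) / log (1 / ε)`, as an extended real number. -/
noncomputable def minkowskiDim {n : ℕ} (E : Set (EuclideanSpace ℝ (Fin n))) : EReal :=
  limsup (fun ε : ℝ =>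
    ENNReal.log (boxCoveringNumber E ε : ENNReal) / ((Real.log (1 / ε) : ℝ) : EReal)) (𝓝[>] 0)

/-- `V` is the vertex set of a convex `k`-gon: `k ≥ 3` points in convex position. -/
def IsConvexPolygonVertexSet (k : ℕ) (V : Finset Plane) : Prop :=
  3 ≤ k ∧ V.card = k ∧ ConvexIndependent ℝ (fun v : V => (v : Plane))

/-- The convex polygon with vertex set `V`, as a closed curve. -/
def polygon (V : Finset Plane) : Set Plane :=
  frontier (convexHull ℝ (V : Set Plane))

/-- All points of `V` lie in the square lattice `m⁻¹ ℤ²` for some positive integer `m`. -/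
def IsLatticeSet (V : Finset Plane) : Prop :=
  ∃ m : ℕ, 0 < m ∧ ∀ v ∈ V, ∀ i, ∃ z : ℤ, v i = (z : ℝ) / (m : ℝ)

/-- Counterclockwise rotation of the plane about the origin by the angle `θ`. -/
noncomputable def rotate (θ : ℝ) (v : Plane) : Plane :=
  !₂[Real.cos θ * v 0 - Real.sin θ * v 1, Real.sin θ * v 0 + Real.cos θ * v 1]

/-- `B` contains a copy of `V`, scaled by some `s > 0` and rotated, with the origin
moved to `x`. -/
def ContainsCopyCenteredAt (B : Set Plane) (V : Finset Plane) (x : Plane) : Prop :=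
  ∃ s θ : ℝ, 0 < s ∧ ∀ v ∈ V, x + s • rotate θ v ∈ B

/-! `B_k` is the set of points whose coordinates `t` have `Nⁿ t` within 1/4 of an integer for every
`n`. Going from scale `N⁻ⁿ` to `N⁻⁽ⁿ⁺¹⁾` keeps at most 3/4 of the `N` subintervals, which lowers the
dimension by a multiple of `1 / log N`. So `N` should be only polynomial in `k`.

The vertices are those of the regular `k`-gon rounded to `(1 + 4b, 4e) / m` with `m = 8k²`. Scaling
and rotating by `m(ω + iw)` puts them at `x₀ + ω(1 + 4b) - 4we` and `x₁ + w(1 + 4b) + 4ωe`. If `Nⁿω`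
and `Nⁿw` are almost in `ℤ/4`, then modulo 1, up to small errors, `b` and `e` drop out. What remains
is one condition on `x₀ + ω` and one on `x₁ + w`, whatever the number of vertices;
`exists_isAdapted` solves each. The errors grow with the numerators, which are `O(k²)`, so `N =
512k²` is enough. -/

/-! ### Box dimension from coverings at geometric scales -/

/-- A box covering with small boxes is a box covering with larger ones. -/
theorem CoveredByBoxes.mono {n : ℕ} {E : Set (EuclideanSpace ℝ (Fin n))} {δ ε : ℝ} {N : ℕ}
    (h : CoveredByBoxes E δ N) (hδ : δ ≤ ε) : CoveredByBoxes E ε N := by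
  obtain ⟨a, b, hab, hE⟩ := h
  exact ⟨a, b, fun j i => ⟨(hab j i).1, (hab j i).2.trans hδ⟩, hE⟩

/-- A geometric bound for the covering numbers along the scales `N⁻ⁿ` bounds the Minkowski
dimension. -/
theorem minkowskiDim_le_log_div_log {d : ℕ} {E : Set (EuclideanSpace ℝ (Fin d))} {N K L : ℕ}
    (hN : 1 < N) (hK : 1 ≤ K) (hL : 1 ≤ L)
    (h : ∀ n : ℕ, ∃ M : ℕ, 0 < M ∧ M ≤ K * L ^ n ∧ CoveredByBoxes E (1 / (N : ℝ) ^ n) M) :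
    minkowskiDim E ≤ ((Real.log L / Real.log N : ℝ) : EReal) := by
  have hN' : (1 : ℝ) < N := by exact_mod_cast hN
  have hK' : (1 : ℝ) ≤ K := by exact_mod_cast hK
  have hL' : (1 : ℝ) ≤ L := by exact_mod_cast hL
  have hlogN : 0 < Real.log N := Real.log_pos hN'
  have hlogL : 0 ≤ Real.log L := Real.log_nonneg hL'
  have hlim : Tendsto (fun ε : ℝ => Real.log (1 / ε)) (𝓝[>] 0) atTop := by
    simp only [one_div]
    exact Real.tendsto_log_atTop.comp (tendsto_inv_nhdsGT_zero (𝕜 := ℝ))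
  have hg : Tendsto (fun ε : ℝ =>
      (Real.log K + Real.log L) / Real.log (1 / ε) + Real.log L / Real.log N) (𝓝[>] 0)
      (𝓝 (Real.log L / Real.log N)) := by
    simpa using (hlim.const_div_atTop (Real.log K + Real.log L)).add_const
      (Real.log L / Real.log N)
  have hg' := (continuous_coe_real_ereal.tendsto _).comp hg
  rw [← hg'.limsup_eq]
  refine limsup_le_limsup ?_
  filter_upwards [hlim.eventually_gt_atTop 0, Ioo_mem_nhdsGT (zero_lt_one' ℝ)] with ε hlog hε
  -- Here `Nⁿ ≤ 1/ε < Nⁿ⁺¹`. Using the finer scale `n + 1` costs one factor `L`, which is negligible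
  -- after division by `log (1/ε)`.
  obtain ⟨n, hn1, hn2⟩ := exists_nat_pow_near (x := 1 / ε) (y := (N : ℝ))
    (by rw [le_div_iff₀ hε.1]; linarith [hε.2]) hN'
  obtain ⟨M, hM0, hM, hcov⟩ := h (n + 1)
  have hcov' : CoveredByBoxes E ε M := hcov.mono (by
    rw [div_le_iff₀ (by positivity)]
    rw [div_lt_iff₀ hε.1] at hn2
    linarith)
  have hbox : boxCoveringNumber E ε ≤ (M : ℕ∞) := iInf₂_le M ⟨hM0, hcov'⟩
  have hbox' : (boxCoveringNumber E ε : ENNReal) ≤ ENNReal.ofReal (K * (L : ℝ) ^ (n + 1)) := by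
    calc (boxCoveringNumber E ε : ENNReal) ≤ ((M : ℕ∞) : ENNReal) := by exact_mod_cast hbox
      _ = (M : ENNReal) := by simp
      _ = ENNReal.ofReal (M : ℝ) := (ENNReal.ofReal_natCast M).symm
      _ ≤ _ := ENNReal.ofReal_le_ofReal (by exact_mod_cast hM)
  have hlog1 := ENNReal.log_le_log hbox'
  rw [ENNReal.log_ofReal_of_pos (by positivity)] at hlog1
  refine (EReal.div_le_div_right_of_nonneg (by exact_mod_cast hlog.le) hlog1).trans ?_
  rw [← EReal.coe_div]
  simp only [Function.comp]
  rw [EReal.coe_le_coe_iff, Real.log_mul (by positivity) (by positivity), Real.log_pow,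
    div_add' _ _ _ hlog.ne']
  refine div_le_div_of_nonneg_right ?_ hlog.le
  have h1 : n * Real.log N ≤ Real.log (1 / ε) := by
    rw [← Real.log_pow]
    exact Real.log_le_log (by positivity) hn1
  have h2 : (n : ℝ) ≤ Real.log (1 / ε) / Real.log N := by rwa [le_div_iff₀ hlogN]
  have h3 : (n : ℝ) * Real.log L ≤ Real.log (1 / ε) / Real.log N * Real.log L := by gcongr
  push_cast
  calc _ = Real.log K + Real.log L + n * Real.log L := by ring
    _ ≤ Real.log K + Real.log L + Real.log (1 / ε) / Real.log N * Real.log L := by gcongr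
    _ = _ := by ring

/-! ### The sparse set and its dimension -/

/-- The reals in `[-R, R]` that are within `N⁻ⁿ / 4` of `N⁻ⁿ ℤ` for every `n`. -/
def sparseReals (N R : ℕ) : Set ℝ :=
  {t | |t| ≤ R ∧ ∀ n : ℕ, ∃ d : ℤ, |(N : ℝ) ^ n * t - d| ≤ 1 / 4}

/-- The points of the plane both of whose coordinates are in `sparseReals N R`. -/
def sparseSet (N R : ℕ) : Set Plane :=
  {y | ∀ i, y i ∈ sparseReals N R}

theorem zero_mem_sparseReals (N R : ℕ) : (0 : ℝ) ∈ sparseReals N R :=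
  ⟨by simp, fun n => ⟨0, by norm_num⟩⟩

/-- Induction on the scale: if `d` is within 1/4 of `Nⁿ t` with `N = 4q`, then `N d` is within `q`
of `Nⁿ⁺¹ t`. This leaves `2q + 1 ≤ 3q` candidates for the next integer. -/
theorem exists_finset_near_sparseReals {q : ℕ} (hq : 1 ≤ q) (R n : ℕ) :
    ∃ S : Finset ℤ, S.card ≤ (2 * R + 3) * (3 * q) ^ n ∧
      ∀ t ∈ sparseReals (4 * q) R, ∃ d ∈ S, |((4 * q : ℕ) : ℝ) ^ n * t - d| ≤ 1 / 4 := by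
  induction n with
  | zero =>
    refine ⟨Finset.Icc (-(R + 1)) (R + 1), ?_, fun t ht => ?_⟩
    · rw [Int.card_Icc]
      simp only [pow_zero, mul_one]
      omega
    · obtain ⟨d, hd⟩ := ht.2 0
      refine ⟨d, ?_, hd⟩
      have h1 := abs_le.1 ht.1
      have h2 := abs_le.1 hd
      simp only [pow_zero, one_mul] at h2
      rw [Finset.mem_Icc]
      constructor
      · have : (-(R + 1) : ℝ) ≤ d := by linarith
        exact_mod_cast this
      · have : (d : ℝ) ≤ R + 1 := by linarith
        exact_mod_cast this
  | succ n ih =>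
    obtain ⟨S, hS, hcov⟩ := ih
    refine ⟨S.biUnion fun d => Finset.Icc (4 * q * d - q) (4 * q * d + q), ?_, fun t ht => ?_⟩
    · calc _ ≤ S.card * (3 * q) := by
            refine Finset.card_biUnion_le_card_mul _ _ _ fun d _ => ?_
            rw [Int.card_Icc]
            omega
        _ ≤ (2 * R + 3) * (3 * q) ^ n * (3 * q) := by gcongr
        _ = _ := by ring
    · obtain ⟨d, hdS, hd⟩ := hcov t ht
      obtain ⟨e, he⟩ := ht.2 (n + 1)
      refine ⟨e, ?_, he⟩
      rw [Finset.mem_biUnion]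
      refine ⟨d, hdS, ?_⟩
      have hq' : (1 : ℝ) ≤ q := by exact_mod_cast hq
      rw [pow_succ'] at he
      push_cast at hd he
      have h1 := abs_le.1 hd
      have h2 := abs_le.1 he
      have h3 : (4 * q : ℝ) * ((4 * q) ^ n * t - d) ≤ q := by nlinarith
      have h4 : -(q : ℝ) ≤ (4 * q : ℝ) * ((4 * q) ^ n * t - d) := by nlinarith
      rw [Finset.mem_Icc]
      constructor
      -- The real bounds give only `q + 1/4`; integrality removes the excess.
      · have : (4 * q * d - q : ℝ) < e + 1 := by linarith
        have : 4 * (q : ℤ) * d - q < e + 1 := by exact_mod_cast this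
        omega
      · have : (e : ℝ) < 4 * q * d + q + 1 := by linarith
        have : e < 4 * (q : ℤ) * d + q + 1 := by exact_mod_cast this
        omega

theorem coveredByBoxes_sparseSet {q : ℕ} (hq : 1 ≤ q) (R n : ℕ) :
    ∃ M : ℕ, 0 < M ∧ M ≤ (2 * R + 3) ^ 2 * ((3 * q) ^ 2) ^ n ∧
      CoveredByBoxes (sparseSet (4 * q) R) (1 / ((4 * q : ℕ) : ℝ) ^ n) M := by
  obtain ⟨S, hS, hcov⟩ := exists_finset_near_sparseReals hq R n
  have hpow : (0 : ℝ) < ((4 * q : ℕ) : ℝ) ^ n := by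
    have : 0 < 4 * q := by omega
    positivity
  have hcard : Fintype.card (Fin 2 → S) = S.card ^ 2 := by simp
  -- The number of boxes must be positive, so `S` has to be nonempty.
  obtain ⟨d₀, hd₀, -⟩ := hcov 0 (zero_mem_sparseReals _ _)
  refine ⟨S.card ^ 2, pow_pos (Finset.card_pos.2 ⟨d₀, hd₀⟩) 2, ?_, ?_⟩
  · calc S.card ^ 2 ≤ ((2 * R + 3) * (3 * q) ^ n) ^ 2 := by gcongr
      _ = _ := by rw [mul_pow, pow_right_comm]
  · let φ : Fin (S.card ^ 2) ≃ (Fin 2 → S) := (Fintype.equivFinOfCardEq hcard).symm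
    refine ⟨fun j i => (((φ j i : ℤ) : ℝ) - 1 / 4) / ((4 * q : ℕ) : ℝ) ^ n,
      fun j i => (((φ j i : ℤ) : ℝ) + 1 / 4) / ((4 * q : ℕ) : ℝ) ^ n, fun j i => ⟨?_, ?_⟩,
      fun y hy => ?_⟩
    · exact div_le_div_of_nonneg_right (by linarith) hpow.le
    · rw [← sub_div]
      exact div_le_div_of_nonneg_right (by linarith) hpow.le
    · choose d hdS hd using fun i => hcov (y i) (hy i)
      refine ⟨φ.symm fun i => ⟨d i, hdS i⟩, fun i => ?_⟩
      have := abs_le.1 (hd i)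
      simp only [Equiv.apply_symm_apply, Set.mem_Icc]
      rw [div_le_iff₀ hpow, le_div_iff₀ hpow]
      constructor <;> linarith

theorem minkowskiDim_sparseSet_le {q : ℕ} (hq : 1 ≤ q) (R : ℕ) :
    minkowskiDim (sparseSet (4 * q) R) ≤
      ((2 - 2 * Real.log (4 / 3) / Real.log (4 * q) : ℝ) : EReal) := by
  have hq' : (1 : ℝ) ≤ q := by exact_mod_cast hq
  have hlog : 0 < Real.log (4 * q) := Real.log_pos (by linarith)
  convert minkowskiDim_le_log_div_log (N := 4 * q) (K := (2 * R + 3) ^ 2) (L := (3 * q) ^ 2)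
    (by omega) (Nat.one_le_pow _ _ (by omega)) (Nat.one_le_pow _ _ (by omega))
    (coveredByBoxes_sparseSet hq R) using 2
  have h : Real.log (3 * q) = Real.log (4 * q) - Real.log (4 / 3) := by
    rw [← Real.log_div (by positivity) (by positivity)]
    congr 1
    ring
  push_cast
  rw [Real.log_pow, h, sub_eq_iff_eq_add, ← add_div, eq_div_iff hlog.ne']
  push_cast
  ring

theorem isBounded_sparseSet (N R : ℕ) : Bornology.IsBounded (sparseSet N R) := by
  refine (Metric.isBounded_iff_subset_closedBall 0).2 ⟨R + R, fun y hy => ?_⟩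
  rw [mem_closedBall_zero_iff, EuclideanSpace.norm_eq]
  refine Real.sqrt_le_iff.2 ⟨by positivity, ?_⟩
  have h0 := (hy 0).1
  have h1 := (hy 1).1
  simp only [Fin.sum_univ_two, Real.norm_eq_abs]
  nlinarith [abs_nonneg (y 0), abs_nonneg (y 1)]

/-! ### Copies inside the sparse set -/

/-- `ω` is at every scale `N⁻ⁿ` very close to a point `p` of the lattice `(4 Nⁿ)⁻¹ ℤ`
for which `ξ + p` is close to the coarser lattice `N⁻ⁿ ℤ`. -/
def IsAdapted (N : ℕ) (ξ ω : ℝ) : Prop :=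
  ∀ n : ℕ, ∃ c d : ℤ, |ω - c / (4 * (N : ℝ) ^ n)| ≤ 2 / (N : ℝ) ^ (n + 1) ∧
    |(N : ℝ) ^ n * ξ + c / 4 - d| ≤ 1 / 8

/-- Successive correction: at scale `n`, move the current value `w` so that `Nⁿ(ξ + w)` is nearly
its nearest integer, then round to `(4Nⁿ)⁻¹ ℤ`. The move is at most `(1/2 + 1/8) N⁻ⁿ`, so the limit
is within `2 N⁻ⁿ⁻¹` of the value chosen at scale `n`. Starting at 4 keeps the limit away from 0. -/
theorem exists_isAdapted {N : ℕ} (hN : 2 ≤ N) (ξ : ℝ) :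
    ∃ ω : ℝ, |ω - 4| ≤ 2 ∧ IsAdapted N ξ ω := by
  have hN' : (2 : ℝ) ≤ N := by exact_mod_cast hN
  have hpow : ∀ n : ℕ, (0 : ℝ) < (N : ℝ) ^ n := fun n => by positivity
  let d : ℕ → ℝ → ℤ := fun n w => round ((N : ℝ) ^ n * (ξ + w))
  let c : ℕ → ℝ → ℤ := fun n w => round (4 * (d n w - (N : ℝ) ^ n * ξ))
  let u : ℕ → ℝ := fun n => Nat.rec 4 (fun n w => c n w / (4 * (N : ℝ) ^ n)) n
  have hu : ∀ n, u (n + 1) = c n (u n) / (4 * (N : ℝ) ^ n) := fun n => rfl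
  have hd : ∀ n w, |(N : ℝ) ^ n * (ξ + w) - d n w| ≤ 1 / 2 := fun n w => abs_sub_round _
  have hc : ∀ n w, |(N : ℝ) ^ n * ξ + c n w / 4 - d n w| ≤ 1 / 8 := fun n w => by
    have h := abs_le.1 (abs_sub_round (4 * (d n w - (N : ℝ) ^ n * ξ)))
    rw [abs_le]
    change -(1 / 2) ≤ 4 * (d n w - (N : ℝ) ^ n * ξ) - c n w ∧
      4 * (d n w - (N : ℝ) ^ n * ξ) - c n w ≤ 1 / 2 at h
    constructor <;> linarith
  have hdist : ∀ n, dist (u n) (u (n + 1)) ≤ 1 * ((N : ℝ)⁻¹) ^ n := fun n => by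
    rw [Real.dist_eq, hu, one_mul, inv_pow, ← one_div, le_div_iff₀ (hpow n),
      ← abs_of_pos (hpow n), ← abs_mul, abs_of_pos (hpow n)]
    have h1 := abs_le.1 (hd n (u n))
    have h2 := abs_le.1 (hc n (u n))
    have h3 : (u n - c n (u n) / (4 * (N : ℝ) ^ n)) * (N : ℝ) ^ n
        = (N : ℝ) ^ n * u n - c n (u n) / 4 := by
      field_simp [(hpow n).ne']
    rw [h3, abs_le]
    constructor <;> linarith
  have hr : (N : ℝ)⁻¹ ≤ 1 / 2 := by
    rw [inv_le_comm₀ (by linarith) (by norm_num)]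
    linarith
  obtain ⟨ω, hω⟩ := cauchySeq_tendsto_of_complete
    (cauchySeq_of_le_geometric _ _ (by linarith) hdist)
  have hlim : ∀ n, |ω - u n| ≤ 2 / (N : ℝ) ^ n := fun n => by
    have h := dist_le_of_le_geometric_of_tendsto _ _ (by linarith) hdist hω n
    rw [dist_comm, Real.dist_eq, one_mul, inv_pow] at h
    refine h.trans ?_
    rw [div_le_iff₀ (by linarith), div_mul_eq_mul_div, ← one_div]
    refine div_le_div_of_nonneg_right ?_ (hpow n).le
    linarith
  refine ⟨ω, by simpa [u] using hlim 0, fun n => ⟨c n (u n), d n (u n), ?_, hc n (u n)⟩⟩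
  rw [← hu]
  exact hlim (n + 1)

theorem add_mul_add_mul_mem_sparseReals {N A : ℕ} (hA : 32 * A ≤ N) (hN : 0 < N)
    {ξ ω η w : ℝ} (hξ : |ξ| ≤ 1) (hω : IsAdapted N ξ ω) (hw : IsAdapted N η w)
    (hω4 : |ω - 4| ≤ 2) (hw4 : |w - 4| ≤ 2) (b e : ℤ)
    (hb : |(1 + 4 * b : ℝ)| ≤ A) (he : |(4 * e : ℝ)| ≤ A) :
    ξ + ω * (1 + 4 * b) + w * (4 * e) ∈ sparseReals N (12 * A + 1) := by
  have hNR : (0 : ℝ) < N := by exact_mod_cast hN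
  have hAR : (32 * A : ℝ) ≤ N := by exact_mod_cast hA
  constructor
  · have h1 : |ω| ≤ 6 := by rw [abs_le] at hω4 ⊢; constructor <;> linarith
    have h2 : |w| ≤ 6 := by rw [abs_le] at hw4 ⊢; constructor <;> linarith
    push_cast
    calc |ξ + ω * (1 + 4 * b) + w * (4 * e)|
        ≤ |ξ| + |ω| * |(1 + 4 * b : ℝ)| + |w| * |(4 * e : ℝ)| := by
          rw [← abs_mul, ← abs_mul]
          exact abs_add_three _ _ _
      _ ≤ 1 + 6 * A + 6 * A := by gcongr
      _ = 12 * A + 1 := by ring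
  · intro n
    obtain ⟨c, d, hc, hd⟩ := hω n
    obtain ⟨c', -, hc', -⟩ := hw n
    have hpow : (0 : ℝ) < (N : ℝ) ^ n := by positivity
    -- Since `(c/4)(1 + 4b) = c/4 + cb` and `(c'/4)(4e) = c'e`, only `c/4` is not an integer. The
    -- total error is `1/8 + 1/16 + 1/16 = 1/4`.
    refine ⟨d + c * b + c' * e, ?_⟩
    push_cast
    have key : (N : ℝ) ^ n * (ξ + ω * (1 + 4 * b) + w * (4 * e)) - (d + c * b + c' * e)
        = ((N : ℝ) ^ n * ξ + c / 4 - d)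
          + (N : ℝ) ^ n * (ω - c / (4 * (N : ℝ) ^ n)) * (1 + 4 * b)
          + (N : ℝ) ^ n * (w - c' / (4 * (N : ℝ) ^ n)) * (4 * e) := by
      field_simp
      ring
    have hsmall : ∀ {r a : ℝ}, |r| ≤ 2 / (N : ℝ) ^ (n + 1) → |a| ≤ A →
        |(N : ℝ) ^ n * r * a| ≤ 1 / 16 := fun {r a} hr ha => by
      rw [abs_mul, abs_mul, abs_of_pos hpow]
      calc (N : ℝ) ^ n * |r| * |a| ≤ (N : ℝ) ^ n * (2 / (N : ℝ) ^ (n + 1)) * A := by gcongr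
        _ = 2 * A / N := by rw [pow_succ]; field_simp
        _ ≤ 1 / 16 := by rw [div_le_iff₀ hNR]; linarith
    rw [key]
    refine (abs_add_three _ _ _).trans ?_
    linarith [hsmall hc hb, hsmall hc' he]

/-- A set of points of `m⁻¹ ℤ²` whose numerators are congruent to `(1, 0)` modulo `4` has a copy
in `sparseSet` around every point of the unit square. -/
theorem containsCopyCenteredAt_sparseSet {N A m : ℕ} (hA : 32 * A ≤ N) (hN : 2 ≤ N) (hm : 0 < m)
    {V : Finset Plane}
    (hV : ∀ v ∈ V, ∃ b e : ℤ, v 0 = (1 + 4 * b) / m ∧ v 1 = 4 * e / m ∧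
      |(1 + 4 * b : ℝ)| ≤ A ∧ |(4 * e : ℝ)| ≤ A)
    {x : Plane} (hx : ∀ i, x i ∈ Set.Icc (0 : ℝ) 1) :
    ContainsCopyCenteredAt (sparseSet N (12 * A + 1)) V x := by
  obtain ⟨ω, hω4, hω⟩ := exists_isAdapted hN (x 0)
  obtain ⟨w, hw4, hw⟩ := exists_isAdapted hN (x 1)
  have hm' : (0 : ℝ) < m := by exact_mod_cast hm
  have hxabs : ∀ i, |x i| ≤ 1 := fun i => by
    rw [abs_of_nonneg (hx i).1]
    exact (hx i).2
  -- Multiplication by `z` is the scaled rotation; the factor `m` clears the denominators of `V`.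
  let z : ℂ := ⟨m * ω, m * w⟩
  have hz : z ≠ 0 := fun h => by
    have h0 : m * ω = 0 := congrArg Complex.re h
    have := abs_le.1 hω4
    nlinarith
  have hcos : ‖z‖ * Real.cos z.arg = m * ω := Complex.norm_mul_cos_arg z
  have hsin : ‖z‖ * Real.sin z.arg = m * w := Complex.norm_mul_sin_arg z
  refine ⟨‖z‖, z.arg, norm_pos_iff.2 hz, fun v hv => ?_⟩
  obtain ⟨b, e, h0, h1, hb, he⟩ := hV v hv
  intro i
  fin_cases i
  · have h : (x + ‖z‖ • rotate z.arg v) 0 = x 0 + ω * (1 + 4 * b) + w * (4 * (-e : ℤ)) := by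
      simp only [rotate, PiLp.add_apply, PiLp.smul_apply, smul_eq_mul, h0, h1]
      simp only [Matrix.cons_val_zero]
      rw [mul_sub, ← mul_assoc, ← mul_assoc, hcos, hsin]
      push_cast
      field_simp
      ring
    simp only [Fin.zero_eta]
    rw [h]
    exact add_mul_add_mul_mem_sparseReals hA (by omega) (hxabs 0) hω hw hω4 hw4 b (-e) hb
      (by push_cast; rwa [mul_neg, abs_neg])
  · have h : (x + ‖z‖ • rotate z.arg v) 1 = x 1 + w * (1 + 4 * b) + ω * (4 * e) := by
      simp only [rotate, PiLp.add_apply, PiLp.smul_apply, smul_eq_mul, h0, h1]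
      simp only [Matrix.cons_val_one, Matrix.cons_val_fin_one]
      rw [mul_add, ← mul_assoc, ← mul_assoc, hcos, hsin]
      field_simp
      ring
    simp only [Fin.mk_one]
    rw [h]
    exact add_mul_add_mul_mem_sparseReals hA (by omega) (hxabs 1) hw hω hw4 hω4 b e hb he

/-! ### Support heights, convex hulls and distance to the circle -/

/-- The linear functional on the plane given by the inner product with `(cos φ, sin φ)`. -/
noncomputable def height (φ : ℝ) : Plane →ₗ[ℝ] ℝ where
  toFun v := Real.cos φ * v 0 + Real.sin φ * v 1
  map_add' v w := by simp; ring
  map_smul' r v := by simp; ring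

theorem height_apply (φ : ℝ) (v : Plane) :
    height φ v = Real.cos φ * v 0 + Real.sin φ * v 1 := rfl

theorem Plane.norm_sq (v : Plane) : ‖v‖ ^ 2 = v 0 ^ 2 + v 1 ^ 2 := by
  rw [EuclideanSpace.norm_sq_eq, Fin.sum_univ_two]
  simp

theorem height_le_norm (φ : ℝ) (v : Plane) : height φ v ≤ ‖v‖ := by
  refine le_of_sq_le_sq ?_ (norm_nonneg v)
  rw [Plane.norm_sq, height_apply]
  have h := Real.sin_sq_add_cos_sq φ
  have h' : v 0 ^ 2 + v 1 ^ 2 = (v 0 ^ 2 + v 1 ^ 2) * (Real.sin φ ^ 2 + Real.cos φ ^ 2) := by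
    rw [h, mul_one]
  rw [h']
  nlinarith [sq_nonneg (Real.cos φ * v 1 - Real.sin φ * v 0)]

theorem exists_polar (a b : ℝ) :
    ∃ r φ : ℝ, 0 ≤ r ∧ a = r * Real.cos φ ∧ b = r * Real.sin φ :=
  ⟨‖(⟨a, b⟩ : ℂ)‖, Complex.arg ⟨a, b⟩, norm_nonneg _, (Complex.norm_mul_cos_arg ⟨a, b⟩).symm,
    (Complex.norm_mul_sin_arg ⟨a, b⟩).symm⟩

theorem exists_height_eq_norm (v : Plane) : ∃ φ, height φ v = ‖v‖ := by
  obtain ⟨r, φ, hr, h0, h1⟩ := exists_polar (v 0) (v 1)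
  have h := Real.sin_sq_add_cos_sq φ
  refine ⟨φ, ?_⟩
  have h2 : ‖v‖ = r := by
    refine (sq_eq_sq₀ (norm_nonneg _) hr).1 ?_
    rw [Plane.norm_sq, h0, h1]
    linear_combination r ^ 2 * h
  rw [h2, height_apply, h0, h1]
  linear_combination r * h

/-- A set that reaches height `a` in every direction has the ball of radius `a` in its hull. -/
theorem closedBall_subset_convexHull {V : Finset Plane} {a : ℝ}
    (h : ∀ φ, ∃ v ∈ V, a ≤ height φ v) :
    Metric.closedBall (0 : Plane) a ⊆ convexHull ℝ (V : Set Plane) := by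
  intro x hx
  rw [mem_closedBall_zero_iff] at hx
  by_contra hxV
  obtain ⟨f, u, hfV, hfx⟩ := geometric_hahn_banach_closed_point (convex_convexHull ℝ _)
    (V.finite_toSet.isClosed_convexHull ℝ) hxV
  obtain ⟨r, φ, hr, h0, h1⟩ := exists_polar (f (EuclideanSpace.single 0 1))
    (f (EuclideanSpace.single 1 1))
  have hf : ∀ v : Plane, f v = r * height φ v := fun v => by
    have hv : v = v 0 • EuclideanSpace.single 0 (1 : ℝ) + v 1 • EuclideanSpace.single 1 (1 : ℝ) := by
      ext i
      fin_cases i <;> simp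
    conv_lhs => rw [hv]
    rw [map_add, map_smul, map_smul, h0, h1, height_apply, smul_eq_mul, smul_eq_mul]
    ring
  obtain ⟨v, hv, hav⟩ := h φ
  have h2 := hfV v (subset_convexHull ℝ _ hv)
  rw [hf] at h2 hfx
  have h3 : r * height φ x ≤ r * height φ v :=
    mul_le_mul_of_nonneg_left (((height_le_norm φ x).trans hx).trans hav) hr
  linarith

/-- A family in which every point is strictly highest in some direction is convexly
independent. -/
theorem isConvexPolygonVertexSet_image {k : ℕ} (hk : 3 ≤ k) (p : ℕ → Plane)
    (h : ∀ i < k, ∃ φ, ∀ j < k, j ≠ i → height φ (p j) < height φ (p i)) :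
    IsConvexPolygonVertexSet k ((Finset.range k).image p) := by
  refine ⟨hk, ?_, ?_⟩
  · rw [Finset.card_image_of_injOn, Finset.card_range]
    intro i hi j hj hij
    by_contra hne
    obtain ⟨φ, hφ⟩ := h i (by simpa using hi)
    exact (hφ j (by simpa using hj) (Ne.symm hne)).ne (by rw [hij])
  · refine convexIndependent_set_iff_notMem_convexHull_sdiff.2 fun x hx hmem => ?_
    obtain ⟨i, hi, rfl⟩ := Finset.mem_image.1 (Finset.mem_coe.1 hx)
    obtain ⟨φ, hφ⟩ := h i (Finset.mem_range.1 hi)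
    have hconv : Convex ℝ {v | height φ v < height φ (p i)} :=
      convex_halfSpace_lt (height φ).isLinear _
    have hsub := convexHull_min (s := (((Finset.range k).image p : Finset Plane) : Set Plane) \ {p i})
      (fun v hv => by
        obtain ⟨j, hj, rfl⟩ := Finset.mem_image.1 (Finset.mem_coe.1 hv.1)
        exact hφ j (Finset.mem_range.1 hj) fun hji => hv.2 (by rw [hji]; rfl)) hconv
    exact lt_irrefl (height φ (p i)) (hsub hmem)

/-- The boundary of a closed set between the balls of radii `1 - r` and `1 + r` is within `r`
of the unit circle. -/
theorem hausdorffEDist_frontier_sphere_le {K : Set Plane} {r : ℝ} (hr : r < 1)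
    (hK : IsClosed K) (hin : Metric.closedBall 0 (1 - r) ⊆ K)
    (hout : K ⊆ Metric.closedBall 0 (1 + r)) :
    Metric.hausdorffEDist (frontier K) (Metric.sphere (0 : Plane) 1) ≤ ENNReal.ofReal r := by
  have hnorm : ∀ x ∈ frontier K, |‖x‖ - 1| ≤ r := fun x hx => by
    have h1 : ‖x‖ ≤ 1 + r := mem_closedBall_zero_iff.1 (hout (hK.frontier_subset hx))
    have h2 : 1 - r ≤ ‖x‖ := by
      by_contra! hlt
      refine hx.2 (mem_interior.2 ⟨Metric.ball 0 (1 - r), Metric.ball_subset_closedBall.trans hin,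
        Metric.isOpen_ball, ?_⟩)
      rwa [mem_ball_zero_iff]
    rw [abs_le]
    constructor <;> linarith
  refine Metric.hausdorffEDist_le_of_mem_edist (fun x hx => ?_) fun x hx => ?_
  · have h := hnorm x hx
    have hpos : 0 < ‖x‖ := by linarith [(abs_le.1 h).1]
    refine ⟨‖x‖⁻¹ • x, ?_, ?_⟩
    · rw [mem_sphere_zero_iff_norm, norm_smul, norm_inv, norm_norm, inv_mul_cancel₀ hpos.ne']
    · rw [edist_dist, dist_eq_norm]
      refine ENNReal.ofReal_le_ofReal ?_
      have : x - ‖x‖⁻¹ • x = ((‖x‖ - 1) * ‖x‖⁻¹) • x := by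
        rw [sub_mul, mul_inv_cancel₀ hpos.ne', sub_smul, one_smul, one_mul]
      rw [this, norm_smul, norm_mul, norm_inv, norm_norm, mul_assoc, inv_mul_cancel₀ hpos.ne',
        mul_one]
      exact h
  · rw [mem_sphere_zero_iff_norm] at hx
    -- The ray through `x` starts in the interior of `K` and leaves `K`, so by connectedness it
    -- meets the frontier.
    obtain ⟨t, ht, htK⟩ : ∃ t : ℝ, 0 ≤ t ∧ t • x ∈ frontier K := by
      by_contra! hno
      have hpre : IsPreconnected ((fun t : ℝ => t • x) '' Set.Ici 0) :=
        isPreconnected_Ici.image _ (by fun_prop)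
      obtain ⟨y, -, hy1, hy2⟩ := hpre (interior K) Kᶜ isOpen_interior hK.isOpen_compl
        (by
          rintro _ ⟨t, ht, rfl⟩
          by_cases h : t • x ∈ K
          · left
            by_contra hint
            exact hno t ht ⟨subset_closure h, hint⟩
          · exact Or.inr h)
        ⟨0, ⟨0, by simp, by simp⟩, mem_interior.2 ⟨Metric.ball 0 (1 - r),
          Metric.ball_subset_closedBall.trans hin, Metric.isOpen_ball, by simpa using hr⟩⟩
        ⟨(3 : ℝ) • x, ⟨3, by simp, rfl⟩, fun h => by
          have := mem_closedBall_zero_iff.1 (hout h)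
          rw [norm_smul, hx] at this
          norm_num at this
          linarith⟩
      exact hy2 (interior_subset hy1)
    refine ⟨t • x, htK, ?_⟩
    have h := hnorm _ htK
    rw [norm_smul, hx, mul_one, Real.norm_of_nonneg ht] at h
    rw [edist_dist, dist_comm, dist_eq_norm]
    refine ENNReal.ofReal_le_ofReal ?_
    have h' : t • x - x = (t - 1) • x := by rw [sub_smul, one_smul]
    rw [h', norm_smul, hx, mul_one]
    exact h

/-! ### The rounded regular polygon -/

/-- The point `(cos θ, sin θ)` of the unit circle, rounded to a point of `m⁻¹ ℤ²` with
numerators congruent to `(1, 0)` modulo `4`. -/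
noncomputable def roundedPoint (m : ℕ) (θ : ℝ) : Plane :=
  !₂[(1 + 4 * (round ((m * Real.cos θ - 1) / 4) : ℤ)) / m,
    4 * (round (m * Real.sin θ / 4) : ℤ) / m]

theorem abs_numerator_cos_sub_le (m : ℕ) (θ : ℝ) :
    |(1 + 4 * (round ((m * Real.cos θ - 1) / 4) : ℤ) : ℝ) - m * Real.cos θ| ≤ 2 := by
  have h := abs_le.1 (abs_sub_round ((m * Real.cos θ - 1) / 4))
  rw [abs_le]
  constructor <;> linarith

theorem abs_numerator_sin_sub_le (m : ℕ) (θ : ℝ) :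
    |(4 * (round (m * Real.sin θ / 4) : ℤ) : ℝ) - m * Real.sin θ| ≤ 2 := by
  have h := abs_le.1 (abs_sub_round (m * Real.sin θ / 4))
  rw [abs_le]
  constructor <;> linarith

theorem abs_height_roundedPoint_sub_le {m : ℕ} (hm : 0 < m) (φ θ : ℝ) :
    |height φ (roundedPoint m θ) - Real.cos (θ - φ)| ≤ 4 / m := by
  have hm' : (0 : ℝ) < m := by exact_mod_cast hm
  rw [height_apply, Real.cos_sub, le_div_iff₀ hm', ← abs_of_pos hm', ← abs_mul]
  have h0 := abs_numerator_cos_sub_le m θ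
  have h1 := abs_numerator_sin_sub_le m θ
  have e : (Real.cos φ * roundedPoint m θ 0 + Real.sin φ * roundedPoint m θ 1
      - (Real.cos θ * Real.cos φ + Real.sin θ * Real.sin φ)) * m
      = Real.cos φ * ((1 + 4 * (round ((m * Real.cos θ - 1) / 4) : ℤ) : ℝ) - m * Real.cos θ)
        + Real.sin φ * ((4 * (round (m * Real.sin θ / 4) : ℤ) : ℝ) - m * Real.sin θ) := by
    simp only [roundedPoint, Matrix.cons_val_zero, Matrix.cons_val_one, Matrix.cons_val_fin_one]
    field_simp
    ring
  rw [e]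
  refine (abs_add_le _ _).trans ?_
  rw [abs_mul, abs_mul]
  have h2 := mul_le_mul (Real.abs_cos_le_one φ) h0 (abs_nonneg _) zero_le_one
  have h3 := mul_le_mul (Real.abs_sin_le_one φ) h1 (abs_nonneg _) zero_le_one
  linarith

theorem norm_roundedPoint_le {m : ℕ} (hm : 0 < m) (θ : ℝ) :
    ‖roundedPoint m θ‖ ≤ 1 + 4 / m := by
  obtain ⟨φ, hφ⟩ := exists_height_eq_norm (roundedPoint m θ)
  have h := (abs_le.1 (abs_height_roundedPoint_sub_le hm φ θ)).2
  linarith [Real.cos_le_one (θ - φ)]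

theorem exists_numerators_roundedPoint {m : ℕ} (hm : 2 ≤ m) (θ : ℝ) :
    ∃ b e : ℤ, roundedPoint m θ 0 = (1 + 4 * b) / m ∧ roundedPoint m θ 1 = 4 * e / m ∧
      |(1 + 4 * b : ℝ)| ≤ (2 * m : ℕ) ∧ |(4 * e : ℝ)| ≤ (2 * m : ℕ) := by
  have hm' : (2 : ℝ) ≤ m := by exact_mod_cast hm
  refine ⟨_, _, rfl, rfl, ?_, ?_⟩
  · have h0 := abs_le.1 (abs_numerator_cos_sub_le m θ)
    have h1 := Real.cos_le_one θ
    have h2 := Real.neg_one_le_cos θ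
    push_cast
    rw [abs_le]
    constructor <;> nlinarith
  · have h0 := abs_le.1 (abs_numerator_sin_sub_le m θ)
    have h1 := Real.sin_le_one θ
    have h2 := Real.neg_one_le_sin θ
    push_cast
    rw [abs_le]
    constructor <;> nlinarith

/-- The vertices of the regular `k`-gon, rounded to denominator `8 k²`. -/
noncomputable def roundedPolygon (k : ℕ) : Finset Plane :=
  (Finset.range k).image fun j : ℕ => roundedPoint (8 * k ^ 2) (2 * Real.pi * j / k)

/-- With `1 - cos 2α = 2 sin² α`, this is Jordan's inequality `sin α ≥ 2α/π`, applied to `α` or `π -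
α`. -/
theorem cos_sub_le_of_ne {k i j : ℕ} (hi : i < k) (hj : j < k) (hij : j ≠ i) :
    Real.cos (2 * Real.pi * j / k - 2 * Real.pi * i / k) ≤ 1 - 8 / (k : ℝ) ^ 2 := by
  wlog hlt : i < j generalizing i j
  · rw [← Real.cos_neg, neg_sub]
    exact this hj hi hij.symm (by omega)
  have hk : (0 : ℝ) < k := by exact_mod_cast (by omega : 0 < k)
  have hπ := Real.pi_pos
  obtain ⟨d, rfl⟩ := Nat.exists_eq_add_of_lt hlt
  have hd : (1 : ℝ) ≤ (d + 1 : ℕ) := by exact_mod_cast (by omega : 1 ≤ d + 1)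
  have hdk : ((d + 1 : ℕ) : ℝ) + 1 ≤ k := by exact_mod_cast (by omega : d + 1 + 1 ≤ k)
  set D : ℝ := ((d + 1 : ℕ) : ℝ) with hD
  have harg : 2 * Real.pi * ((i + d + 1 : ℕ) : ℝ) / k - 2 * Real.pi * i / k
      = 2 * (Real.pi * D / k) := by
    rw [hD]
    push_cast
    ring
  have hsin : 2 / k ≤ Real.sin (Real.pi * D / k) := by
    by_cases hhalf : 2 * D ≤ k
    · have h := Real.mul_le_sin (x := Real.pi * D / k) (by positivity) (by
        rw [div_le_div_iff₀ hk (by norm_num)]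
        nlinarith)
      refine le_trans ?_ h
      rw [div_mul_div_comm, mul_left_comm, mul_div_mul_left _ _ hπ.ne']
      exact div_le_div_of_nonneg_right (by linarith) hk.le
    · have e : Real.pi - Real.pi * D / k = Real.pi * (k - D) / k := by field_simp
      rw [← Real.sin_pi_sub, e]
      have h := Real.mul_le_sin (x := Real.pi * (k - D) / k)
        (div_nonneg (mul_nonneg hπ.le (by linarith)) hk.le) (by
        rw [div_le_div_iff₀ hk (by norm_num)]
        nlinarith)
      refine le_trans ?_ h
      rw [div_mul_div_comm, mul_left_comm, mul_div_mul_left _ _ hπ.ne']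
      exact div_le_div_of_nonneg_right (by linarith) hk.le
  have hsq : (2 / (k : ℝ)) ^ 2 ≤ Real.sin (Real.pi * D / k) ^ 2 := by gcongr
  rw [harg, Real.cos_two_mul, Real.cos_sq']
  have : (2 / (k : ℝ)) ^ 2 = 4 / k ^ 2 := by ring
  have : 8 / (k : ℝ) ^ 2 = 2 * (4 / k ^ 2) := by ring
  linarith

/-- Rounding changes each height by at most `4/m = 1/(2k²)`, less than half the gap `8/k²` between
the regular vertices, so each vertex stays strictly highest in its own direction. -/
theorem isConvexPolygonVertexSet_roundedPolygon {k : ℕ} (hk : 3 ≤ k) :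
    IsConvexPolygonVertexSet k (roundedPolygon k) := by
  refine isConvexPolygonVertexSet_image hk _ fun i hi =>
    ⟨2 * Real.pi * i / k, fun j hj hji => ?_⟩
  have hm : 0 < 8 * k ^ 2 := by positivity
  have h1 := abs_le.1 (abs_height_roundedPoint_sub_le hm (2 * Real.pi * i / k)
    (2 * Real.pi * i / k))
  have h2 := abs_le.1 (abs_height_roundedPoint_sub_le hm (2 * Real.pi * i / k)
    (2 * Real.pi * j / k))
  have h3 := cos_sub_le_of_ne hi hj hji
  rw [sub_self, Real.cos_zero] at h1
  have hk' : (0 : ℝ) < 1 / (k : ℝ) ^ 2 := by positivity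
  have h4 : (4 : ℝ) / ((8 * k ^ 2 : ℕ) : ℝ) = 1 / 2 * (1 / (k : ℝ) ^ 2) := by
    push_cast
    field_simp
    norm_num
  have h5 : 8 / (k : ℝ) ^ 2 = 8 * (1 / (k : ℝ) ^ 2) := by ring
  rw [h4] at h1 h2
  linarith [h1.1, h2.2]

theorem exists_cos_pi_div_le_cos_sub {k : ℕ} (hk : 0 < k) (φ : ℝ) :
    ∃ j < k, Real.cos (Real.pi / k) ≤ Real.cos (2 * Real.pi * j / k - φ) := by
  have hk' : (0 : ℝ) < k := by exact_mod_cast hk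
  have hkz : (0 : ℤ) < k := by exact_mod_cast hk
  have hπ := Real.pi_pos
  let J : ℤ := round (φ * k / (2 * Real.pi))
  have hJ := abs_sub_round (φ * k / (2 * Real.pi))
  -- The nearest multiple of `2π/k` to `φ` has index `J`; reducing `J` modulo `k` shifts the angle
  -- by a multiple of `2π`.
  obtain ⟨j, hj⟩ := Int.eq_ofNat_of_zero_le (Int.emod_nonneg J hkz.ne')
  refine ⟨j, by have := Int.emod_lt_of_pos J hkz; omega, ?_⟩
  have hdiv : (J : ℝ) = j + k * (J / k : ℤ) := by
    have := Int.emod_add_mul_ediv J k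
    rw [hj] at this
    exact_mod_cast this.symm
  have e : 2 * Real.pi * j / k - φ
      = -(φ * k / (2 * Real.pi) - J) * (2 * Real.pi / k) - (J / k : ℤ) * (2 * Real.pi) := by
    rw [hdiv]
    field_simp
    ring
  rw [e, Real.cos_sub_int_mul_two_pi, neg_mul, Real.cos_neg,
    ← Real.cos_abs (_ * (2 * Real.pi / k))]
  refine Real.cos_le_cos_of_nonneg_of_le_pi (abs_nonneg _)
    (div_le_self hπ.le (by exact_mod_cast hk)) ?_
  rw [abs_mul, abs_of_pos (by positivity : 0 < 2 * Real.pi / k)]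
  calc _ ≤ 1 / 2 * (2 * Real.pi / k) := by gcongr
    _ = Real.pi / k := by ring

/-- A bound for the distance of the rounded `k`-gon from the unit circle. -/
noncomputable def roundedPolygonError (k : ℕ) : ℝ :=
  1 - Real.cos (Real.pi / k) + 1 / (2 * (k : ℝ) ^ 2)

theorem four_div_denominator (k : ℕ) :
    (4 : ℝ) / ((8 * k ^ 2 : ℕ) : ℝ) = 1 / (2 * (k : ℝ) ^ 2) := by
  push_cast
  rw [show (8 * (k : ℝ) ^ 2) = 4 * (2 * (k : ℝ) ^ 2) by ring, ← div_div, div_self (by norm_num)]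

theorem closedBall_subset_convexHull_roundedPolygon {k : ℕ} (hk : 3 ≤ k) :
    Metric.closedBall 0 (1 - roundedPolygonError k) ⊆
      convexHull ℝ (roundedPolygon k : Set Plane) := by
  refine closedBall_subset_convexHull fun φ => ?_
  obtain ⟨j, hj, hcos⟩ := exists_cos_pi_div_le_cos_sub (by omega : 0 < k) φ
  refine ⟨_, Finset.mem_image_of_mem _ (Finset.mem_range.2 hj), ?_⟩
  have h := (abs_le.1 (abs_height_roundedPoint_sub_le (by positivity : 0 < 8 * k ^ 2) φ
    (2 * Real.pi * j / k))).1
  rw [four_div_denominator] at h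
  rw [roundedPolygonError]
  linarith

theorem convexHull_roundedPolygon_subset {k : ℕ} (hk : 3 ≤ k) :
    convexHull ℝ (roundedPolygon k : Set Plane) ⊆
      Metric.closedBall 0 (1 + roundedPolygonError k) := by
  refine convexHull_min (fun v hv => ?_) (convex_closedBall _ _)
  obtain ⟨j, -, rfl⟩ := Finset.mem_image.1 (Finset.mem_coe.1 hv)
  rw [mem_closedBall_zero_iff]
  refine (norm_roundedPoint_le (by positivity) _).trans ?_
  rw [four_div_denominator, roundedPolygonError]
  linarith [Real.cos_le_one (Real.pi / k)]

theorem roundedPolygonError_lt_one {k : ℕ} (hk : 3 ≤ k) : roundedPolygonError k < 1 := by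
  have hk' : (3 : ℝ) ≤ k := by exact_mod_cast hk
  have h1 : 1 / 2 ≤ Real.cos (Real.pi / k) := by
    rw [← Real.cos_pi_div_three]
    refine Real.cos_le_cos_of_nonneg_of_le_pi (by positivity) (by linarith [Real.pi_pos]) ?_
    gcongr
  have h2 : 1 / (2 * (k : ℝ) ^ 2) < 1 / 2 := by
    gcongr
    nlinarith
  rw [roundedPolygonError]
  linarith

theorem tendsto_roundedPolygonError : Tendsto roundedPolygonError atTop (𝓝 0) := by
  have h1 : Tendsto (fun k : ℕ => Real.cos (Real.pi / k)) atTop (𝓝 1) := by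
    have := (Real.continuous_cos.tendsto 0).comp (tendsto_const_div_atTop_nhds_zero_nat Real.pi)
    rwa [Real.cos_zero] at this
  have h2 : Tendsto (fun k : ℕ => 1 / (2 * (k : ℝ) ^ 2)) atTop (𝓝 0) := by
    refine Tendsto.const_div_atTop (Tendsto.const_mul_atTop (by norm_num) ?_) 1
    exact (tendsto_pow_atTop two_ne_zero).comp tendsto_natCast_atTop_atTop
  have h := (h1.const_sub 1).add h2
  rwa [sub_self, add_zero] at h

theorem zero_mem_interior_convexHull_roundedPolygon {k : ℕ} (hk : 3 ≤ k) :
    (0 : Plane) ∈ interior (convexHull ℝ (roundedPolygon k : Set Plane)) :=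
  mem_interior.2 ⟨Metric.ball 0 (1 - roundedPolygonError k),
    Metric.ball_subset_closedBall.trans (closedBall_subset_convexHull_roundedPolygon hk),
    Metric.isOpen_ball, by simpa using roundedPolygonError_lt_one hk⟩

theorem tendsto_hausdorffEDist_roundedPolygon :
    Tendsto (fun k : ℕ =>
      Metric.hausdorffEDist (polygon (roundedPolygon k)) (Metric.sphere (0 : Plane) 1))
      atTop (𝓝 0) := by
  have h := (ENNReal.continuous_ofReal.tendsto 0).comp tendsto_roundedPolygonError
  rw [ENNReal.ofReal_zero] at h
  refine tendsto_of_tendsto_of_tendsto_of_le_of_le' tendsto_const_nhds h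
    (Eventually.of_forall fun _ => bot_le) ?_
  filter_upwards [eventually_ge_atTop 3] with k hk
  exact hausdorffEDist_frontier_sphere_le (roundedPolygonError_lt_one hk)
    ((roundedPolygon k).finite_toSet.isClosed_convexHull ℝ)
    (closedBall_subset_convexHull_roundedPolygon hk) (convexHull_roundedPolygon_subset hk)

theorem exists_numerators_of_mem_roundedPolygon {k : ℕ} (hk : 3 ≤ k) {v : Plane}
    (hv : v ∈ roundedPolygon k) :
    ∃ b e : ℤ, v 0 = (1 + 4 * b) / (8 * k ^ 2 : ℕ) ∧ v 1 = 4 * e / (8 * k ^ 2 : ℕ) ∧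
      |(1 + 4 * b : ℝ)| ≤ (2 * (8 * k ^ 2) : ℕ) ∧ |(4 * e : ℝ)| ≤ (2 * (8 * k ^ 2) : ℕ) := by
  obtain ⟨j, -, rfl⟩ := Finset.mem_image.1 hv
  exact exists_numerators_roundedPoint (by nlinarith) _

theorem isLatticeSet_roundedPolygon {k : ℕ} (hk : 3 ≤ k) : IsLatticeSet (roundedPolygon k) := by
  refine ⟨8 * k ^ 2, by positivity, fun v hv i => ?_⟩
  obtain ⟨b, e, h0, h1, -, -⟩ := exists_numerators_of_mem_roundedPolygon hk hv
  fin_cases i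
  · exact ⟨1 + 4 * b, by push_cast at h0 ⊢; exact h0⟩
  · exact ⟨4 * e, by push_cast at h1 ⊢; exact h1⟩

/-! ### Constants and conclusion -/

theorem log_base_le {k : ℕ} (hk : 3 ≤ k) :
    Real.log (4 * (128 * k ^ 2 : ℕ)) ≤ 8 * Real.log k := by
  have hk' : (3 : ℝ) ≤ k := by exact_mod_cast hk
  have h : (3 : ℝ) ^ 6 ≤ (k : ℝ) ^ 6 := by gcongr
  rw [show (8 : ℝ) * Real.log k = (8 : ℕ) * Real.log k by norm_num, ← Real.log_pow]
  refine Real.log_le_log (by positivity) ?_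
  push_cast
  calc 4 * (128 * (k : ℝ) ^ 2) = 512 * (k : ℝ) ^ 2 := by ring
    _ ≤ (k : ℝ) ^ 6 * (k : ℝ) ^ 2 := by gcongr; linarith
    _ = (k : ℝ) ^ 8 := by ring

theorem mainTheorem8 :
    ∃ c : ℝ, 0 < c ∧ ∃ (V : ℕ → Finset Plane) (B : ℕ → Set Plane),
      (∀ k : ℕ, 3 ≤ k →
        IsConvexPolygonVertexSet k (V k) ∧ IsLatticeSet (V k) ∧
          (0 : Plane) ∈ interior (convexHull ℝ (V k : Set Plane))) ∧
      Tendsto (fun k : ℕ => Metric.hausdorffEDist (polygon (V k)) (Metric.sphere (0 : Plane) 1))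
        atTop (𝓝 0) ∧
      ∀ k : ℕ, 3 ≤ k →
        Bornology.IsBounded (B k) ∧
          (∀ x : Plane, (∀ i, x i ∈ Set.Icc (0 : ℝ) 1) → ContainsCopyCenteredAt (B k) (V k) x) ∧
          minkowskiDim (B k) ≤ ((2 - c / Real.log (k : ℝ) : ℝ) : EReal) := by
  have hlog : 0 < Real.log (4 / 3) := Real.log_pos (by norm_num)
  -- The dimension drop is `2 log(4/3) / log N`, and `log N ≤ 8 log k` because `512 ≤ 3⁶ ≤ k⁶`;
  -- hence `2/8 = 1/4`.
  refine ⟨Real.log (4 / 3) / 4, by positivity, roundedPolygon,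
    fun k => sparseSet (4 * (128 * k ^ 2)) (12 * (2 * (8 * k ^ 2)) + 1),
    fun k hk => ⟨isConvexPolygonVertexSet_roundedPolygon hk, isLatticeSet_roundedPolygon hk,
      zero_mem_interior_convexHull_roundedPolygon hk⟩,
    tendsto_hausdorffEDist_roundedPolygon, fun k hk => ⟨isBounded_sparseSet _ _, fun x hx => ?_, ?_⟩⟩
  · exact containsCopyCenteredAt_sparseSet (m := 8 * k ^ 2) (by omega) (by nlinarith)
      (by positivity) (fun v hv => exists_numerators_of_mem_roundedPolygon hk hv) hx
  · refine (minkowskiDim_sparseSet_le (by nlinarith) _).trans ?_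
    rw [EReal.coe_le_coe_iff]
    have hk' : (3 : ℝ) ≤ k := by exact_mod_cast hk
    have hlogk : 0 < Real.log k := Real.log_pos (by linarith)
    have hq : (1 : ℝ) ≤ (128 * k ^ 2 : ℕ) := by exact_mod_cast (by nlinarith : 1 ≤ 128 * k ^ 2)
    have hlogN : 0 < Real.log (4 * (128 * k ^ 2 : ℕ)) := Real.log_pos (by linarith)
    refine sub_le_sub_left ?_ 2
    rw [div_div, div_le_div_iff₀ (by positivity) hlogN]
    nlinarith [log_base_le hk]
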